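/- Let $\{a_n\}_{n\in\mathbb Z}$, $\{p_n\}_{n\in\mathbb Z}$, $\{q_n\}_{n\in\mathbb Z}$ be complex sequences with $a_n\neq 0$ for all $n\in\mathbb Z$ and $$\sum_{n\in\mathbb Z}|n|\,\bigl(|1-a_n|+|p_n|+|q_n|\bigr)<\infty .$$ For $\lambda\in\mathbb C$ let $L_\lambda$ be the bounded operator on $\ell^2(\mathbb Z)$ given by $$(L_\lambda y)_n=\Delta\bigl(a_{n-1}\Delta y_{n-1}\bigr)+\bigl(q_n+2\lambda p_n+\lambda^2\bigr)y_n,\qquad n\in\mathbb Z,$$ where $\Delta u_n=u_{n+1}-u_n$. Let the continuous spectrum $\sigma_c(L_\lambda)$ of this quadratic pencil be the set of all $\lambda\in\mathbb C$ for which $L_\lambda$ is injective and has dense range in $\ell^2(\mathbb Z)$, but has no bounded inverse defined on all of $\ell^2(\mathbb Z)$. Then $$\sigma_c(L_\lambda)=[-2,2].$$ -/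

import Mathlib

/-- The summability condition
`∑_{n ∈ ℤ} |n| (|1 - a n| + |p n| + |q n|) < ∞` on the coefficient sequences. -/
def SummabilityCondition (a p q : ℤ → ℂ) : Prop :=
  Summable fun n : ℤ => |(n : ℝ)| * (‖1 - a n‖ + ‖p n‖ + ‖q n‖)

/-- The difference expression
`L_λ y n = Δ (a (n - 1) Δ y (n - 1)) + (q n + 2 λ p n + λ ^ 2) y n`, where `Δ u n = u (n + 1) - u n`,
evaluated on an arbitrary two-sided sequence `y`. -/
def pencilExpr (a p q : ℤ → ℂ) (lam : ℂ) (y : ℤ → ℂ) (n : ℤ) : ℂ :=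
  fwdDiff 1 (fun k : ℤ => a (k - 1) * fwdDiff 1 y (k - 1)) n
    + (q n + 2 * lam * p n + lam ^ 2) * y n

theorem pencilExpr_eq (a p q : ℤ → ℂ) (lam : ℂ) (y : ℤ → ℂ) (n : ℤ) :
    pencilExpr a p q lam y n = a n * (y (n + 1) - y n) - a (n - 1) * (y n - y (n - 1))
      + (q n + 2 * lam * p n + lam ^ 2) * y n := by
  simp [pencilExpr, fwdDiff]

/-- Under the summability condition all three coefficient sequences are bounded. -/
theorem SummabilityCondition.bounded {a p q : ℤ → ℂ} (h : SummabilityCondition a p q) :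
    ∃ C : ℝ, ∀ n, ‖a n‖ ≤ C ∧ ‖p n‖ ≤ C ∧ ‖q n‖ ≤ C := by
  set S : ℝ := ∑' n : ℤ, |(n : ℝ)| * (‖1 - a n‖ + ‖p n‖ + ‖q n‖)
  refine ⟨max (1 + S) (‖a 0‖ + ‖p 0‖ + ‖q 0‖), fun n => ?_⟩
  have ha := norm_nonneg (a 0)
  have hp := norm_nonneg (p 0)
  have hq := norm_nonneg (q 0)
  by_cases hn : n = 0
  · subst hn
    refine ⟨le_max_of_le_right ?_, le_max_of_le_right ?_, le_max_of_le_right ?_⟩ <;> linarith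
  · have h1 : |(n : ℝ)| * (‖1 - a n‖ + ‖p n‖ + ‖q n‖) ≤ S :=
      Summable.le_tsum h n (fun j _ => by positivity)
    have h2 : (1 : ℝ) ≤ |(n : ℝ)| := by exact_mod_cast Int.one_le_abs hn
    have h3 : 0 ≤ ‖1 - a n‖ + ‖p n‖ + ‖q n‖ := by positivity
    have h4 : ‖1 - a n‖ + ‖p n‖ + ‖q n‖ ≤ S := by nlinarith
    have h5 : ‖a n‖ ≤ 1 + ‖1 - a n‖ := by
      have := norm_sub_le (1 : ℂ) (1 - a n)
      simpa using this
    have := norm_nonneg (1 - a n)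
    have := norm_nonneg (p n)
    have := norm_nonneg (q n)
    refine ⟨le_max_of_le_left ?_, le_max_of_le_left ?_, le_max_of_le_left ?_⟩ <;> linarith

theorem memlp_two_bdd_mul_shift {c y : ℤ → ℂ} {C : ℝ} (hc : ∀ n, ‖c n‖ ≤ C)
    (hy : Memℓp (E := fun _ : ℤ => ℂ) y 2) (k : ℤ) :
    Memℓp (E := fun _ : ℤ => ℂ) (fun n => c n * y (n + k)) 2 := by
  have hs := hy.summable (by norm_num)
  have hs' : Summable fun n : ℤ => C ^ (2 : ℕ) * ‖y (n + k)‖ ^ (2 : ENNReal).toReal :=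
    (((Equiv.addRight k).summable_iff).2 hs).mul_left _
  refine memℓp_gen (Summable.of_nonneg_of_le (fun n => by positivity) (fun n => ?_) hs')
  simp only [ENNReal.toReal_ofNat, Real.rpow_ofNat, norm_mul, mul_pow]
  gcongr
  exact hc n

/-- Under the summability condition the difference expression maps `ℓ²(ℤ)` to itself. -/
theorem SummabilityCondition.pencilExpr_memlp {a p q : ℤ → ℂ} (h : SummabilityCondition a p q)
    (lam : ℂ) {y : ℤ → ℂ} (hy : Memℓp (E := fun _ : ℤ => ℂ) y 2) :
    Memℓp (E := fun _ : ℤ => ℂ) (pencilExpr a p q lam y) 2 := by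
  obtain ⟨C, hC⟩ := h.bounded
  have h1 := memlp_two_bdd_mul_shift (fun n => (hC n).1) hy 1
  have h2 := memlp_two_bdd_mul_shift (c := fun n => a (n - 1)) (fun n => (hC (n - 1)).1) hy (-1)
  have h3 := memlp_two_bdd_mul_shift (c := fun n => q n + 2 * lam * p n + lam ^ 2 - a n - a (n - 1))
    (C := C + ‖2 * lam‖ * C + ‖lam ^ 2‖ + C + C) (fun n => by
      refine (norm_sub_le _ _).trans (add_le_add ((norm_sub_le _ _).trans (add_le_add
        ((norm_add_le _ _).trans (add_le_add ((norm_add_le _ _).trans (add_le_add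
          (hC n).2.2 ?_)) le_rfl)) (hC n).1)) (hC (n - 1)).1)
      rw [norm_mul]
      exact mul_le_mul_of_nonneg_left (hC n).2.1 (norm_nonneg _)) hy 0
  convert (h1.add h2).add h3 using 1
  funext n
  simp only [pencilExpr_eq, Pi.add_apply, add_zero, ← sub_eq_add_neg]
  ring

/-- The Hilbert space `ℓ²(ℤ)` of complex square summable two-sided sequences. -/
abbrev EllTwo : Type := lp (fun _ : ℤ => ℂ) 2

/-- The linear map of `ℓ²(ℤ)` given by the difference expression. -/
def pencilLinearMap (a p q : ℤ → ℂ) (h : SummabilityCondition a p q) (lam : ℂ) :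
    EllTwo →ₗ[ℂ] EllTwo where
  toFun y := ⟨pencilExpr a p q lam y, h.pencilExpr_memlp lam (lp.memℓp y)⟩
  map_add' y z := by
    apply lp.ext
    funext n
    simp only [lp.coeFn_add, Pi.add_apply, pencilExpr_eq]
    ring
  map_smul' c y := by
    apply lp.ext
    funext n
    simp only [lp.coeFn_smul, Pi.smul_apply, pencilExpr_eq, smul_eq_mul, RingHom.id_apply]
    ring

theorem pencilLinearMap_continuous (a p q : ℤ → ℂ) (h : SummabilityCondition a p q) (lam : ℂ) :
    Continuous (pencilLinearMap a p q h lam) := by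
  refine LinearMap.continuous_of_seq_closed_graph _ fun u x y hu hy => ?_
  have ev : ∀ n : ℤ, Continuous fun f : EllTwo => f n := fun n =>
    (lp.lipschitzWith_one_eval (E := fun _ : ℤ => ℂ) 2 n).continuous
  apply lp.ext
  funext n
  refine tendsto_nhds_unique (((ev n).tendsto y).comp hy) ?_
  have h0 := ((ev n).tendsto x).comp hu
  have h1 := ((ev (n + 1)).tendsto x).comp hu
  have h2 := ((ev (n - 1)).tendsto x).comp hu
  have h3 := (((h1.sub h0).const_mul (a n)).sub ((h0.sub h2).const_mul (a (n - 1)))).add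
    (h0.const_mul (q n + 2 * lam * p n + lam ^ 2))
  have e : ∀ v : EllTwo, pencilLinearMap a p q h lam v n =
      a n * (v (n + 1) - v n) - a (n - 1) * (v n - v (n - 1))
        + (q n + 2 * lam * p n + lam ^ 2) * v n := fun v => pencilExpr_eq a p q lam v n
  rw [e]
  exact h3.congr fun k => (e (u k)).symm

/-- The operator `L_λ` generated in `ℓ²(ℤ)` by the difference expression; under the summability
condition it is an everywhere defined bounded operator. -/
def pencilOperator (a p q : ℤ → ℂ) (h : SummabilityCondition a p q) (lam : ℂ) :
    EllTwo →L[ℂ] EllTwo :=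
  ⟨pencilLinearMap a p q h lam, pencilLinearMap_continuous a p q h lam⟩

/-- The resolvent set of an operator pencil `T`: those `λ` for which the operator `T λ` has a
bounded inverse defined on the whole space. -/
def pencilResolventSet {E : Type*} [NormedAddCommGroup E] [NormedSpace ℂ E]
    (T : ℂ → E →L[ℂ] E) : Set ℂ :=
  {lam | IsUnit (T lam)}

/-- The continuous spectrum of an operator pencil `T`: those `λ` outside the resolvent set
for which `T λ` is injective and has dense range. -/
def pencilContinuousSpectrum {E : Type*} [NormedAddCommGroup E] [NormedSpace ℂ E]
    (T : ℂ → E →L[ℂ] E) : Set ℂ :=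
  {lam | lam ∉ pencilResolventSet T ∧ Function.Injective (T lam) ∧ DenseRange (T lam)}

/-! Let `w`, `w⁻¹` be the characteristic roots of the free equation `y (n + 1) + y (n - 1) = (2 -
λ²) y n`; then `‖w‖ = 1` exactly when `λ ∈ [-2, 2]`.

If `‖w‖ ≠ 1`, the free operator is invertible, since the spectrum of the shift lies on the unit
circle, and `L_λ` differs from it by a compact operator. By the Fredholm alternative an injective
`L_λ` is invertible, so `λ` is not in the continuous spectrum.

If `‖w‖ = 1`, the first-moment condition excludes nonzero null solutions on either half-line
(`eventually_eq_zero_of_second_order`), double roots `w = ±1` included. The equation at `n = 0` is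
not needed for this, so the same fact shows both that `L_λ` is injective and that the unit vector at
`0` is not in its range. Density of the range follows from injectivity because the matrix of `L_λ`
is symmetric. -/

open Filter Topology

/-! ### Null solutions on a half-line -/

/-- If `∑ (n + 1) v n` converges, then the sequence of tail sums of `v` is summable. -/
theorem summable_tail_tsum {v : ℕ → ℝ} (hv : ∀ n, 0 ≤ v n)
    (hs : Summable fun n : ℕ => ((n : ℝ) + 1) * v n) :
    Summable fun n : ℕ => ∑' k, v (n + k) := by
  have h : Summable fun x : ℕ × ℕ => v (x.1 + x.2) := by
    -- Summed along antidiagonals, `v n` occurs `n + 1` times.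
    rw [← Finset.HasAntidiagonal.sigmaAntidiagonalEquivProd.summable_iff]
    refine (summable_sigma_of_nonneg (fun x => hv _)).2 ?_
    refine ⟨fun n => Summable.of_finite, ?_⟩
    refine hs.congr fun n => ?_
    have e : ∀ x : Finset.HasAntidiagonal.antidiagonal n, v (x.1.1 + x.1.2) = v n := fun x => by
      rw [Finset.HasAntidiagonal.mem_antidiagonal.1 x.2]
    simp [e]
  exact h.prod

/-- A null sequence satisfying a perturbed first order recurrence with unimodular coefficient is
bounded by the sum of the perturbations. -/
theorem norm_le_tsum_of_first_order {x : ℕ → ℂ} {g : ℕ → ℝ} {w : ℂ} (hw : ‖w‖ = 1)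
    (hx : Tendsto x atTop (𝓝 0)) (hg : Summable g)
    (hxg : ∀ k, ‖x (k + 1) - w * x k‖ ≤ g k) : ‖x 0‖ ≤ ∑' k, g k := by
  have key : ∀ m, ‖x 0‖ ≤ ‖x m‖ + ∑ k ∈ Finset.range m, g k := by
    intro m
    induction m with
    | zero => simp
    | succ m ih =>
      rw [Finset.sum_range_succ]
      have h1 : ‖x m‖ = ‖w * x m‖ := by simp [hw]
      have h2 : ‖w * x m‖ ≤ ‖x (m + 1)‖ + ‖x (m + 1) - w * x m‖ := norm_le_insert _ _
      have := hxg m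
      linarith
  have lim := hx.norm.add hg.hasSum.tendsto_sum_nat
  rw [norm_zero, zero_add] at lim
  exact ge_of_tendsto' lim key

/-- Null solutions of a perturbation, with finite first moment, of the recurrence with
unimodular characteristic roots `w`, `w⁻¹` vanish eventually. -/
theorem eventually_eq_zero_of_second_order {y : ℕ → ℂ} {v : ℕ → ℝ} {w : ℂ} (hw : ‖w‖ = 1)
    (hv : ∀ n, 0 ≤ v n) (hs : Summable fun n : ℕ => ((n : ℝ) + 1) * v n)
    (hy : Tendsto y atTop (𝓝 0))
    (hyv : ∀ n, ‖y (n + 2) + y n - (w + w⁻¹) * y (n + 1)‖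
      ≤ v n * (‖y n‖ + ‖y (n + 1)‖ + ‖y (n + 2)‖)) :
    ∃ N, ∀ n ≥ N, y n = 0 := by
  have hw0 : w ≠ 0 := by
    rintro rfl
    simp at hw
  have hvs : Summable v := Summable.of_nonneg_of_le hv
    (fun n => by nlinarith [hv n, (Nat.cast_nonneg n : (0 : ℝ) ≤ n)]) hs
  set T : ℕ → ℝ := fun n => ∑' k, v (n + k) with hT
  have hTs : Summable T := summable_tail_tsum hv hs
  have hlim : Tendsto (fun n => ∑' k, T (k + n)) atTop (𝓝 0) := tendsto_sum_nat_add T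
  -- With `1 / 6`, the bound `3 * M` on three consecutive terms, summed twice over tails, returns at
  -- most `M / 2`.
  obtain ⟨N, hN⟩ := eventually_atTop.1 (hlim.eventually (eventually_le_nhds
    (show (0 : ℝ) < 1 / 6 by norm_num)))
  have step : ∀ M : ℝ, (∀ n ≥ N, ‖y n‖ ≤ M) → ∀ n ≥ N, ‖y n‖ ≤ M / 2 := by
    intro M hM
    have hM0 : 0 ≤ M := (norm_nonneg _).trans (hM N le_rfl)
    -- The recurrence factors as `(S - w⁻¹)(S - w)` with `S` the shift. Each unimodular first-order
    -- factor costs one tail summation, which is why a first moment is required.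
    set u : ℕ → ℂ := fun k => y (k + 1) - w * y k with hu
    have hu0 : Tendsto u atTop (𝓝 0) := by
      have := ((tendsto_add_atTop_iff_nat 1).2 hy).sub (hy.const_mul w)
      simpa using this
    have hub : ∀ n ≥ N, ‖u n‖ ≤ T n * (3 * M) := by
      intro n hn
      have h1 : Tendsto (fun k => u (n + k)) atTop (𝓝 0) := by
        simpa [add_comm] using (tendsto_add_atTop_iff_nat n).2 hu0
      have h2 : Summable fun k => v (n + k) * (3 * M) := by
        have : Summable fun k => v (n + k) := by
          simpa [add_comm] using (summable_nat_add_iff n).2 hvs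
        exact this.mul_right _
      have h3 := norm_le_tsum_of_first_order (w := w⁻¹) (by simp [hw]) h1 h2 (fun k => by
        have e : u (n + (k + 1)) - w⁻¹ * u (n + k)
            = y (n + k + 2) + y (n + k) - (w + w⁻¹) * y (n + k + 1) := by
          simp only [hu, ← add_assoc]
          field_simp
          ring
        rw [e]
        refine (hyv (n + k)).trans (mul_le_mul_of_nonneg_left ?_ (hv _))
        have a1 := hM (n + k) (by omega)
        have a2 := hM (n + k + 1) (by omega)
        have a3 := hM (n + k + 2) (by omega)
        linarith)
      rwa [tsum_mul_right] at h3
    intro n hn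
    have h1 : Tendsto (fun k => y (n + k)) atTop (𝓝 0) := by
      simpa [add_comm] using (tendsto_add_atTop_iff_nat n).2 hy
    have h2 : Summable fun k => T (k + n) * (3 * M) :=
      ((summable_nat_add_iff n).2 hTs).mul_right _
    have h3 := norm_le_tsum_of_first_order hw h1 h2 (fun k => by
      have := hub (n + k) (by omega)
      rwa [show T (n + k) = T (k + n) by rw [add_comm]] at this)
    rw [tsum_mul_right] at h3
    have := hN n hn
    simp only [add_zero] at h3
    nlinarith
  obtain ⟨M, hM⟩ : ∃ M, ∀ n, ‖y n‖ ≤ M := by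
    obtain ⟨M, hM⟩ := hy.norm.bddAbove_range
    exact ⟨M, fun n => hM ⟨n, rfl⟩⟩
  have iter : ∀ j : ℕ, ∀ n ≥ N, ‖y n‖ ≤ M * (1 / 2) ^ j := by
    intro j
    induction j with
    | zero => simpa using fun n _ => hM n
    | succ j ih =>
      intro n hn
      refine (step _ ih n hn).trans_eq ?_
      ring
  refine ⟨N, fun n hn => ?_⟩
  have lim : Tendsto (fun j : ℕ => M * (1 / 2 : ℝ) ^ j) atTop (𝓝 (M * 0)) :=
    (tendsto_pow_atTop_nhds_zero_of_lt_one (by norm_num) (by norm_num)).const_mul M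
  rw [mul_zero] at lim
  exact norm_le_zero_iff.1 (ge_of_tendsto' lim fun j => iter j n hn)

/-- A half-line Jacobi equation whose coefficients are close, in the sense of first moments, to
the constant ones with characteristic roots `w`, `w⁻¹` on the unit circle has no nonzero null
solution. -/
theorem jacobi_eq_zero_of_tendsto {y α β : ℕ → ℂ} {w : ℂ} (hw : ‖w‖ = 1) (hα : ∀ n, α n ≠ 0)
    (hs : Summable fun n : ℕ =>
      ((n : ℝ) + 1) * (‖1 - α n‖ + ‖1 - α (n + 1)‖ + ‖β n + (w + w⁻¹)‖))
    (hy : Tendsto y atTop (𝓝 0))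
    (heq : ∀ n, α (n + 1) * y (n + 2) + α n * y n + β n * y (n + 1) = 0) (n : ℕ) : y n = 0 := by
  obtain ⟨N, hN⟩ := eventually_eq_zero_of_second_order hw (fun n => by positivity) hs hy
    (fun n => by
      have e : y (n + 2) + y n - (w + w⁻¹) * y (n + 1) = (1 - α (n + 1)) * y (n + 2)
          + (1 - α n) * y n - (β n + (w + w⁻¹)) * y (n + 1) := by
        linear_combination heq n
      rw [e]
      refine (norm_sub_le _ _).trans ((add_le_add_left (norm_add_le _ _) _).trans ?_)
      simp only [norm_mul]
      have h1 := norm_nonneg (1 - α n)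
      have h2 := norm_nonneg (1 - α (n + 1))
      have h3 := norm_nonneg (β n + (w + w⁻¹))
      have h4 := norm_nonneg (y n)
      have h5 := norm_nonneg (y (n + 1))
      have h6 := norm_nonneg (y (n + 2))
      generalize ‖1 - α n‖ = A at *
      generalize ‖1 - α (n + 1)‖ = B at *
      generalize ‖β n + (w + w⁻¹)‖ = C at *
      nlinarith [mul_nonneg h1 h5, mul_nonneg h1 h6, mul_nonneg h2 h4, mul_nonneg h2 h5,
        mul_nonneg h3 h4, mul_nonneg h3 h6])
  -- Since `α N ≠ 0`, the recurrence determines `y N` from the next two terms, so vanishing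
  -- propagates backwards.
  induction N generalizing n with
  | zero => exact hN n (Nat.zero_le n)
  | succ N ih =>
    refine ih n fun k hk => ?_
    rcases hk.lt_or_eq with h | rfl
    · exact hN k h
    · have := heq N
      rw [hN (N + 1) le_rfl, hN (N + 2) (by omega)] at this
      simpa [hα N] using this

/-! ### Characteristic roots and the spectral parameter -/

theorem exists_root_recurrence (c : ℂ) : ∃ w : ℂ, w ≠ 0 ∧ w + w⁻¹ = c := by
  obtain ⟨s, hs⟩ := IsAlgClosed.exists_pow_nat_eq (c ^ 2 - 4) (show 0 < 2 by norm_num)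
  have h0 : (c + s) / 2 ≠ 0 := fun h => by
    have h1 : c = -s := by linear_combination 2 * h
    rw [h1] at hs
    have : (4 : ℂ) = 0 := by linear_combination hs
    norm_num at this
  refine ⟨(c + s) / 2, h0, ?_⟩
  field_simp
  have hcs : c + s ≠ 0 := fun h => h0 (by rw [h, zero_div])
  field_simp
  linear_combination hs

/-- The spectral parameters for which the characteristic roots lie on the unit circle. -/
theorem mem_Icc_iff_root {lam w : ℂ} (hw0 : w ≠ 0) (hw : w + w⁻¹ = 2 - lam ^ 2) :
    lam ∈ (fun x : ℝ => (x : ℂ)) '' Set.Icc (-2 : ℝ) 2 ↔ ‖w‖ = 1 := by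
  constructor
  · rintro ⟨x, hx, rfl⟩
    have e : w ^ 2 - (2 - (x : ℂ) ^ 2) * w + 1 = 0 := by
      rw [← hw]
      field_simp
      ring
    have er := congrArg Complex.re e
    have ei := congrArg Complex.im e
    obtain ⟨u, v⟩ := w
    simp [pow_two] at er ei
    have hn : u * u + v * v = 1 := by
      -- A real root forces a zero discriminant, hence `w = ±1`; otherwise the imaginary part gives
      -- `2 * u = 2 - x * x`, and the real part then gives modulus one.
      by_cases hv : v = 0
      · subst hv
        have h1 : x * x ≤ 4 := by nlinarith [hx.1, hx.2]
        have h2 : (2 - x * x) * (2 - x * x) ≤ 4 := by nlinarith [mul_self_nonneg x]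
        have h3 : u - (2 - x * x) / 2 = 0 := by
          have : (u - (2 - x * x) / 2) ^ 2 ≤ 0 := by nlinarith
          exact pow_eq_zero_iff two_ne_zero |>.1 (le_antisymm this (sq_nonneg _))
        nlinarith
      · have h1 : 2 * u = 2 - x * x := by
          apply mul_right_cancel₀ hv
          linarith
        rw [← h1] at er
        linarith
    rw [Complex.norm_def, Complex.normSq_mk, hn, Real.sqrt_one]
  · intro h
    have hinv : w⁻¹ = (starRingEnd ℂ) w := Complex.inv_eq_conj h
    rw [hinv, Complex.add_conj] at hw
    have hre := Complex.abs_re_le_norm w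
    rw [h, abs_le] at hre
    have er := congrArg Complex.re hw
    have ei := congrArg Complex.im hw
    obtain ⟨x, y⟩ := lam
    simp [pow_two] at er ei
    have hy : y = 0 := by
      have hxy : x * y = 0 := by linarith
      rcases mul_eq_zero.1 hxy with rfl | hy
      · nlinarith
      · exact hy
    subst hy
    exact ⟨x, ⟨by nlinarith, by nlinarith⟩, rfl⟩

/-! ### Restriction of the pencil to the half-lines -/

/-- Square summable sequences tend to zero. -/
theorem EllTwo.tendsto_cofinite (y : EllTwo) : Tendsto (fun n : ℤ => y n) cofinite (𝓝 0) := by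
  have hs := (lp.memℓp y).summable (by norm_num)
  simp only [ENNReal.toReal_ofNat, Real.rpow_ofNat] at hs
  have h := (Real.continuous_sqrt.tendsto 0).comp hs.tendsto_cofinite_zero
  rw [tendsto_zero_iff_norm_tendsto_zero]
  simpa [Function.comp_def, Real.sqrt_sq] using h

/-- The weights `1 + |n|` and `|n|` are comparable except at `n = 0`, a single term. -/
theorem SummabilityCondition.summable_weight {a p q : ℤ → ℂ} (h : SummabilityCondition a p q) :
    Summable fun n : ℤ => (1 + |(n : ℝ)|) * (‖1 - a n‖ + ‖p n‖ + ‖q n‖) := by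
  refine Summable.of_norm_bounded_eventually (h.mul_left 2) ?_
  have : ∀ n : ℤ, n ≠ 0 → ‖(1 + |(n : ℝ)|) * (‖1 - a n‖ + ‖p n‖ + ‖q n‖)‖
      ≤ 2 * (|(n : ℝ)| * (‖1 - a n‖ + ‖p n‖ + ‖q n‖)) := by
    intro n hn
    have h2 : (1 : ℝ) ≤ |(n : ℝ)| := by exact_mod_cast Int.one_le_abs hn
    rw [Real.norm_of_nonneg (by positivity), ← mul_assoc]
    gcongr
    linarith
  filter_upwards [(Set.finite_singleton (0 : ℤ)).compl_mem_cofinite] with n hn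
  exact this n hn

/-- The coefficients of the half-line equations obtained by restricting the pencil satisfy the
first moment condition. -/
theorem SummabilityCondition.summable_shift {a p q : ℤ → ℂ} (h : SummabilityCondition a p q)
    (lam c : ℂ) (hc : c = 2 - lam ^ 2) (i j : ℕ → ℤ) (hi : i.Injective) (hj : j.Injective)
    (hin : ∀ n : ℕ, (n : ℝ) ≤ |(i n : ℝ)|) (hjn : ∀ n : ℕ, (n : ℝ) ≤ |(j n : ℝ)|)
    (α β : ℕ → ℂ)
    (hα : ∀ n, ‖1 - α n‖ + ‖1 - α (n + 1)‖ = ‖1 - a (i n)‖ + ‖1 - a (j n)‖)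
    (hβ : ∀ n, β n = q (i n) + 2 * lam * p (i n) + lam ^ 2 - a (i n) - a (j n)) :
    Summable fun n : ℕ => ((n : ℝ) + 1) * (‖1 - α n‖ + ‖1 - α (n + 1)‖ + ‖β n + c‖) := by
  have hW := h.summable_weight
  refine Summable.of_nonneg_of_le (fun n => by positivity) (fun n => ?_)
    (((hW.comp_injective hi).add (hW.comp_injective hj)).mul_left (2 + 2 * ‖lam‖))
  have e : β n + c = q (i n) + 2 * lam * p (i n) + ((1 - a (i n)) + (1 - a (j n))) := by
    rw [hβ, hc]; ring
  have e1 : ‖β n + c‖ ≤ ‖q (i n)‖ + 2 * ‖lam‖ * ‖p (i n)‖ + (‖1 - a (i n)‖ + ‖1 - a (j n)‖) := by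
    rw [e]
    refine (norm_add_le _ _).trans (add_le_add ((norm_add_le _ _).trans_eq ?_) (norm_add_le _ _))
    simp
  rw [hα]
  set s : ℤ → ℝ := fun n => ‖1 - a n‖ + ‖p n‖ + ‖q n‖ with hsdef
  have hs0 : ∀ n, 0 ≤ s n := fun n => by positivity
  have e2 : ‖1 - a (i n)‖ + ‖1 - a (j n)‖ + ‖β n + c‖ ≤ (2 + 2 * ‖lam‖) * (s (i n) + s (j n)) := by
    simp only [hsdef]
    nlinarith [norm_nonneg (1 - a (i n)), norm_nonneg (1 - a (j n)), norm_nonneg (p (i n)),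
      norm_nonneg (p (j n)), norm_nonneg (q (i n)), norm_nonneg (q (j n)), norm_nonneg lam,
      mul_nonneg (norm_nonneg lam) (norm_nonneg (1 - a (i n))),
      mul_nonneg (norm_nonneg lam) (norm_nonneg (1 - a (j n))),
      mul_nonneg (norm_nonneg lam) (norm_nonneg (p (j n))),
      mul_nonneg (norm_nonneg lam) (norm_nonneg (q (i n))),
      mul_nonneg (norm_nonneg lam) (norm_nonneg (q (j n)))]
  calc ((n : ℝ) + 1) * (‖1 - a (i n)‖ + ‖1 - a (j n)‖ + ‖β n + c‖)
      ≤ ((n : ℝ) + 1) * ((2 + 2 * ‖lam‖) * (s (i n) + s (j n))) := by gcongr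
    _ = (2 + 2 * ‖lam‖) * (((n : ℝ) + 1) * s (i n) + ((n : ℝ) + 1) * s (j n)) := by ring
    _ ≤ (2 + 2 * ‖lam‖) * ((1 + |(i n : ℝ)|) * s (i n) + (1 + |(j n : ℝ)|) * s (j n)) := by
      have := hin n
      have := hjn n
      gcongr ?_ * (?_ * _ + ?_ * _)
      · linarith
      · linarith

/-- On the continuous spectrum a null sequence solving the pencil equation away from the origin
vanishes. -/
theorem eq_zero_of_pencilExpr_eq_zero {a p q : ℤ → ℂ} (ha : ∀ n : ℤ, a n ≠ 0)
    (h : SummabilityCondition a p q) {lam w : ℂ} (hw : ‖w‖ = 1) (hlam : w + w⁻¹ = 2 - lam ^ 2)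
    {y : ℤ → ℂ} (hy : Tendsto y cofinite (𝓝 0)) (heq : ∀ n ≠ 0, pencilExpr a p q lam y n = 0) :
    y = 0 := by
  have hi1 : Function.Injective fun n : ℕ => (n : ℤ) := fun m n e => by simpa using e
  have hi2 : Function.Injective fun n : ℕ => (n : ℤ) + 1 := fun m n e => by simpa using e
  have hi3 : Function.Injective fun n : ℕ => -(n : ℤ) := fun m n e => by simpa using e
  have hi4 : Function.Injective fun n : ℕ => -(n : ℤ) - 1 := fun m n e => by simpa using e
  have hi5 : Function.Injective fun n : ℕ => -(n : ℤ) - 2 := fun m n e => by simpa using e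
  -- The equations at `n ≥ 1` and those at `n ≤ -1` both involve `y 0`, so the two half-lines cover
  -- all sites without the equation at `0`.
  have right : ∀ n : ℕ, y n = 0 := by
    refine jacobi_eq_zero_of_tendsto (y := fun n : ℕ => y n) (α := fun n : ℕ => a n)
      (β := fun n : ℕ => q (n + 1) + 2 * lam * p (n + 1) + lam ^ 2 - a (n + 1) - a n) hw
      (fun n => ha _) ?_ ?_ ?_
    · refine h.summable_shift lam _ hlam (fun n => (n : ℤ) + 1) (fun n => n) hi2 hi1 ?_ ?_ _ _
        ?_ ?_
      · intro n; push_cast; rw [abs_of_nonneg (by positivity)]; linarith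
      · intro n; push_cast; rw [abs_of_nonneg (by positivity)]
      · intro n; push_cast; ring
      · intro n; rfl
    · rw [← Nat.cofinite_eq_atTop]
      exact hy.comp hi1.tendsto_cofinite
    · intro n
      have e := heq (n + 1) (by omega)
      rw [pencilExpr_eq, show (n : ℤ) + 1 + 1 = n + 2 by ring, add_sub_cancel_right] at e
      push_cast
      linear_combination e
  have left : ∀ n : ℕ, y (-n) = 0 := by
    refine jacobi_eq_zero_of_tendsto (y := fun n : ℕ => y (-n)) (α := fun n : ℕ => a (-n - 1))
      (β := fun n : ℕ => q (-n - 1) + 2 * lam * p (-n - 1) + lam ^ 2 - a (-n - 1) - a (-n - 2)) hw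
      (fun n => ha _) ?_ ?_ ?_
    · refine h.summable_shift lam _ hlam (fun n => -(n : ℤ) - 1) (fun n => -(n : ℤ) - 2) hi4 hi5
        ?_ ?_ _ _ ?_ ?_
      · intro n; push_cast
        rw [abs_of_nonpos (by linarith [(Nat.cast_nonneg n : (0 : ℝ) ≤ n)])]; linarith
      · intro n; push_cast
        rw [abs_of_nonpos (by linarith [(Nat.cast_nonneg n : (0 : ℝ) ≤ n)])]; linarith
      · intro n; push_cast
        rw [show -((n : ℤ) + 1) - 1 = -n - 2 by ring]
      · intro n; rfl
    · rw [← Nat.cofinite_eq_atTop]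
      exact hy.comp hi3.tendsto_cofinite
    · intro n
      have e := heq (-n - 1) (by omega)
      rw [pencilExpr_eq, sub_add_cancel, show -(n : ℤ) - 1 - 1 = -n - 2 by ring] at e
      push_cast
      rw [show -((n : ℤ) + 1) - 1 = -n - 2 by ring, show -((n : ℤ) + 2) = -n - 2 by ring,
        show -((n : ℤ) + 1) = -n - 1 by ring]
      linear_combination e
  funext n
  obtain ⟨k, rfl | rfl⟩ := n.eq_nat_or_neg
  · exact right k
  · exact left k

/-! ### Invertibility off the unit circle -/

/-- The bilateral shift on `ℓ²(ℤ)` as a unitary map. -/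
def ellTwoShift : EllTwo ≃ₗᵢ[ℂ] EllTwo where
  toFun y := ⟨fun n => y (n + 1), (by
    simpa using memlp_two_bdd_mul_shift (c := fun _ => 1) (C := 1) (by simp) (lp.memℓp y) 1 :
      Memℓp (E := fun _ : ℤ => ℂ) (fun n => y (n + 1)) 2)⟩
  invFun y := ⟨fun n => y (n - 1), (by
    simpa [sub_eq_add_neg] using
      memlp_two_bdd_mul_shift (c := fun _ => 1) (C := 1) (by simp) (lp.memℓp y) (-1) :
      Memℓp (E := fun _ : ℤ => ℂ) (fun n => y (n - 1)) 2)⟩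
  map_add' y z := rfl
  map_smul' c y := rfl
  left_inv y := by
    apply lp.ext
    funext n
    simp
  right_inv y := by
    apply lp.ext
    funext n
    simp
  norm_map' y := by
    rw [lp.norm_eq_tsum_rpow (by norm_num), lp.norm_eq_tsum_rpow (by norm_num)]
    congr 1
    exact (Equiv.addRight (1 : ℤ)).tsum_eq fun n : ℤ => ‖y n‖ ^ (2 : ENNReal).toReal

theorem isUnit_shift_sub {z : ℂ} (hz : ‖z‖ ≠ 1) :
    IsUnit (algebraMap ℂ (EllTwo →L[ℂ] EllTwo) z
      - (ellTwoShift.toContinuousLinearEquiv : EllTwo →L[ℂ] EllTwo)) := by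
  by_contra hc
  have h1 := spectrum.subset_circle_of_unitary
    (Unitary.linearIsometryEquiv.symm ellTwoShift).2 (a := z) hc
  exact hz (by simpa using h1)

/-- The free operator `y ↦ y (n + 1) + y (n - 1) - (w + w⁻¹) y n` is invertible off the unit
circle. -/
theorem exists_isUnit_free {w : ℂ} (hw0 : w ≠ 0) (hw : ‖w‖ ≠ 1) :
    ∃ A : EllTwo →L[ℂ] EllTwo, IsUnit A ∧
      ∀ y n, A y n = y (n + 1) + y (n - 1) - (w + w⁻¹) * y n := by
  have hu : IsUnit (ellTwoShift.symm.toContinuousLinearEquiv : EllTwo →L[ℂ] EllTwo) :=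
    ContinuousLinearMap.isUnit_iff_bijective.2 ellTwoShift.symm.bijective
  have hw' : ‖w⁻¹‖ ≠ 1 := by simpa using hw
  -- With `S` the shift, `S⁻¹ (w - S)(w⁻¹ - S) = S + S⁻¹ - (w + w⁻¹)`.
  refine ⟨_, (hu.mul (isUnit_shift_sub hw)).mul (isUnit_shift_sub hw'), fun y n => ?_⟩
  have e : ∀ (z : ℂ) (v : EllTwo) (m : ℤ), (algebraMap ℂ (EllTwo →L[ℂ] EllTwo) z
      - (ellTwoShift.toContinuousLinearEquiv : EllTwo →L[ℂ] EllTwo)) v m = z * v m - v (m + 1) :=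
    fun z v m => by
      rw [Algebra.algebraMap_eq_smul_one]
      rfl
  have e' : ∀ (v : EllTwo) (m : ℤ),
      (ellTwoShift.symm.toContinuousLinearEquiv : EllTwo →L[ℂ] EllTwo) v m = v (m - 1) :=
    fun v m => rfl
  simp only [mul_apply_eq_comp, e, e', sub_add_cancel]
  field_simp
  ring

/-- An operator on `ℓ²(ℤ)` whose coordinate functionals have summable norms is compact. -/
theorem exists_isCompactOperator_of_summable (φ : ℤ → EllTwo →L[ℂ] ℂ)
    (hφ : Summable fun n => ‖φ n‖) :
    ∃ K : EllTwo →L[ℂ] EllTwo, IsCompactOperator K ∧ ∀ y n, K y n = φ n y := by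
  set R : ℤ → EllTwo →L[ℂ] EllTwo := fun n => (φ n).smulRight (lp.single 2 n (1 : ℂ)) with hR
  have hRn : ∀ n, ‖R n‖ = ‖φ n‖ := fun n => by
    rw [hR, ContinuousLinearMap.norm_smulRight_apply, lp.norm_single (by norm_num)]
    simp
  have hs : Summable R := Summable.of_norm (by simpa only [hRn] using hφ)
  refine ⟨∑' n, R n, ?_, fun y m => ?_⟩
  -- The rank-one series converges in norm, so its sum is a limit of finite-rank operators.
  · refine isCompactOperator_of_tendsto hs.hasSum (Eventually.of_forall fun s => ?_)
    have hc : ∀ n, IsCompactOperator (R n) := fun n =>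
      (isCompactOperator_of_locallyCompactSpace_dom (φ n)).clm_comp
        (((ContinuousLinearMap.id ℂ ℂ).smulRight (lp.single 2 n (1 : ℂ) : EllTwo) :
          ℂ →L[ℂ] EllTwo))
    classical
    induction s using Finset.induction_on with
    | empty => simpa using isCompactOperator_zero
    | insert n s hn ih =>
      rw [Finset.sum_insert hn]
      exact (hc n).add ih
  · have h1 : HasSum (fun n => R n y m) ((∑' n, R n) y m) :=
      ((hs.hasSum.mapL (ContinuousLinearMap.apply ℂ EllTwo y)).mapL
        (lp.evalCLM ℂ (fun _ : ℤ => ℂ) 2 m))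
    refine h1.unique ?_
    have h2 : (fun n => R n y m) m = φ m y := by
      simp [hR]
    rw [← h2]
    refine hasSum_single m fun n hn => ?_
    simp [hR, Pi.single_eq_of_ne' hn]

/-- The Fredholm alternative for compact perturbations of invertible operators. -/
theorem isUnit_add_of_isCompactOperator {E : Type*} [NormedAddCommGroup E] [NormedSpace ℂ E]
    [CompleteSpace E] {A K : E →L[ℂ] E} (hA : IsUnit A) (hK : IsCompactOperator K)
    (hinj : Function.Injective (A + K)) : IsUnit (A + K) := by
  obtain ⟨u, rfl⟩ := hA
  have hc : IsCompactOperator ((↑u⁻¹ : E →L[ℂ] E) * K) := hK.clm_comp (↑u⁻¹ : E →L[ℂ] E)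
  -- Invertibility reduces to whether the nonzero number `-1` is an eigenvalue of the compact
  -- operator `A⁻¹K`.
  have e : (u : E →L[ℂ] E) + K
      = -((u : E →L[ℂ] E) * (algebraMap ℂ (E →L[ℂ] E) (-1) - (↑u⁻¹ : E →L[ℂ] E) * K)) := by
    rw [mul_sub, ← mul_assoc, Units.mul_inv]
    simp [add_comm]
  rcases hc.hasEigenvalue_or_mem_resolventSet (μ := -1) (by simp) with h | h
  · exfalso
    obtain ⟨x, hx⟩ := h.exists_hasEigenvector
    have hx1 : (↑u⁻¹ : E →L[ℂ] E) (K x) = (-1 : ℂ) • x := hx.apply_eq_smul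
    refine hx.2 (hinj ?_)
    rw [map_zero, e]
    simp [hx1]
  · rw [e]
    exact (u.isUnit.mul h).neg

theorem pencilOperator_apply {a p q : ℤ → ℂ} (h : SummabilityCondition a p q) (lam : ℂ)
    (y : EllTwo) : ⇑(pencilOperator a p q h lam y) = pencilExpr a p q lam y := rfl

/-- Away from `[-2, 2]`, an injective `L_λ` is boundedly invertible. -/
theorem isUnit_pencilOperator_of_injective {a p q : ℤ → ℂ} (h : SummabilityCondition a p q)
    {lam w : ℂ} (hw0 : w ≠ 0) (hw : ‖w‖ ≠ 1) (hlam : w + w⁻¹ = 2 - lam ^ 2)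
    (hinj : Function.Injective (pencilOperator a p q h lam)) :
    IsUnit (pencilOperator a p q h lam) := by
  obtain ⟨A, hA, hAy⟩ := exists_isUnit_free hw0 hw
  set ev : ℤ → EllTwo →L[ℂ] ℂ := fun n => lp.evalCLM ℂ (fun _ : ℤ => ℂ) 2 n
  have hevy : ∀ n y, ev n y = y n := fun _ _ => rfl
  have hevn : ∀ n, ‖ev n‖ ≤ 1 := fun n => ContinuousLinearMap.opNorm_le_bound _ zero_le_one
    fun y => by simpa [hevy] using lp.norm_apply_le_norm (by norm_num) y n
  have hs : Summable fun n => ‖1 - a n‖ + ‖p n‖ + ‖q n‖ :=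
    Summable.of_nonneg_of_le (fun n => by positivity)
      (fun n => le_mul_of_one_le_left (by positivity) (by simp)) h.summable_weight
  have hsa : Summable fun n => ‖1 - a n‖ := Summable.of_nonneg_of_le (fun n => norm_nonneg _)
    (fun n => by linarith [norm_nonneg (p n), norm_nonneg (q n)]) hs
  have hsp : Summable fun n => ‖p n‖ := Summable.of_nonneg_of_le (fun n => norm_nonneg _)
    (fun n => by linarith [norm_nonneg (1 - a n), norm_nonneg (q n)]) hs
  have hsq : Summable fun n => ‖q n‖ := Summable.of_nonneg_of_le (fun n => norm_nonneg _)
    (fun n => by linarith [norm_nonneg (1 - a n), norm_nonneg (p n)]) hs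
  have hsa' : Summable fun n => ‖1 - a (n - 1)‖ :=
    hsa.comp_injective (i := fun n => n - 1) sub_left_injective
  have hqp : Summable fun n => ‖q n + 2 * lam * p n‖ :=
    Summable.of_nonneg_of_le (fun n => norm_nonneg _) (fun n => (norm_add_le _ _).trans_eq (by
      rw [norm_mul])) (hsq.add (hsp.mul_left ‖2 * lam‖))
  have haa : Summable fun n => ‖(1 - a n) + (1 - a (n - 1))‖ :=
    Summable.of_nonneg_of_le (fun n => norm_nonneg _) (fun n => norm_add_le _ _) (hsa.add hsa')
  have bound : ∀ (c : ℤ → ℂ) (g : ℤ → ℤ), Summable (fun n => ‖c n‖) →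
      Summable fun n => ‖c n • ev (g n)‖ := fun c g hc =>
    Summable.of_nonneg_of_le (fun n => norm_nonneg _) (fun n => by
      rw [norm_smul]
      exact mul_le_of_le_one_right (norm_nonneg _) (hevn _)) hc
  have nadd : ∀ f g : ℤ → EllTwo →L[ℂ] ℂ, Summable (fun n => ‖f n‖) →
      Summable (fun n => ‖g n‖) → Summable fun n => ‖f n + g n‖ := fun f g hf hg =>
    Summable.of_nonneg_of_le (fun n => norm_nonneg _) (fun n => norm_add_le _ _) (hf.add hg)
  obtain ⟨K, hK, hKy⟩ := exists_isCompactOperator_of_summable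
    (fun n => (q n + 2 * lam * p n) • ev n + ((1 - a n) + (1 - a (n - 1))) • ev n
      + ((a n - 1) • ev (n + 1) + (a (n - 1) - 1) • ev (n - 1)))
    (nadd _ _ (nadd _ _ (bound _ _ hqp) (bound _ _ haa)) (nadd _ _
      (bound _ (fun n => n + 1) (by simpa only [norm_sub_rev] using hsa))
      (bound _ (fun n => n - 1) (by simpa only [norm_sub_rev] using hsa'))))
  have e : pencilOperator a p q h lam = A + K := by
    ext y n
    rw [pencilOperator_apply, pencilExpr_eq]
    change _ = A y n + K y n
    rw [hAy, hKy, hlam]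
    simp [hevy]
    ring
  rw [e] at hinj ⊢
  exact isUnit_add_of_isCompactOperator hA hK hinj

/-! ### Dense range and the conclusion -/

/-- The matrix of `L_λ` is symmetric, so the range of an injective `L_λ` is dense. -/
theorem denseRange_pencilOperator {a p q : ℤ → ℂ} (h : SummabilityCondition a p q) {lam : ℂ}
    (hinj : Function.Injective (pencilOperator a p q h lam)) :
    DenseRange (pencilOperator a p q h lam) := by
  set L := pencilOperator a p q h lam with hL
  have hbot : (L.range)ᗮ = ⊥ := by
    rw [Submodule.eq_bot_iff]
    intro v hv
    -- The matrix is symmetric but not Hermitian: orthogonality of `v` to its columns says that the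
    -- conjugate of `v` lies in the kernel.
    have hz : pencilExpr a p q lam (star v : EllTwo) = 0 := by
      funext m
      let e : ℤ → ℂ → EllTwo := fun n c => lp.single 2 n c
      have h1 : inner ℂ v (L (lp.single 2 m (1 : ℂ))) = 0 :=
        Submodule.inner_left_of_mem_orthogonal (LinearMap.mem_range_self _ _) hv
      have e1 : L (lp.single 2 m (1 : ℂ)) = e (m - 1) (a (m - 1))
          + e (m + 1) (a m)
          + e m (q m + 2 * lam * p m + lam ^ 2 - a m - a (m - 1)) := by
        apply lp.ext
        funext n
        rw [hL, pencilOperator_apply, pencilExpr_eq]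
        simp only [e, lp.coeFn_add, Pi.add_apply, lp.coeFn_single, Pi.single_apply]
        rcases eq_or_ne n m with rfl | h1
        · simp [show n ≠ n - 1 by omega]
          ring
        rcases eq_or_ne n (m - 1) with rfl | h2
        · simp [show m - 1 ≠ m by omega, show m - 1 - 1 ≠ m by omega,
            show m - 1 ≠ m + 1 by omega]
        rcases eq_or_ne n (m + 1) with rfl | h3
        · simp [show m + 1 ≠ m by omega, show m + 1 + 1 ≠ m by omega,
            show m + 1 ≠ m - 1 by omega]
        simp [h1, h2, h3, show n + 1 ≠ m by omega, show n - 1 ≠ m by omega]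
      rw [e1, inner_add_right, inner_add_right, lp.inner_single_right, lp.inner_single_right,
        lp.inner_single_right] at h1
      simp only [RCLike.inner_apply] at h1
      rw [pencilExpr_eq]
      simp only [lp.coeFn_star, Pi.star_apply, RCLike.star_def, Pi.zero_apply]
      linear_combination h1
    have h0 : (star v : EllTwo) = 0 := hinj (by
      rw [map_zero]
      apply lp.ext
      exact hz)
    simpa using h0
  have h1 := (Submodule.topologicalClosure_eq_top_iff (K := L.range)).2 hbot
  exact (Submodule.dense_iff_topologicalClosure_eq_top).2 h1

theorem theorem4 (a p q : ℤ → ℂ) (ha : ∀ n : ℤ, a n ≠ 0) (h : SummabilityCondition a p q) :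
    pencilContinuousSpectrum (pencilOperator a p q h) =
      (fun x : ℝ => (x : ℂ)) '' Set.Icc (-2 : ℝ) 2 := by
  ext lam
  obtain ⟨w, hw0, hlam⟩ := exists_root_recurrence (2 - lam ^ 2)
  rw [mem_Icc_iff_root hw0 hlam]
  constructor
  · rintro ⟨h1, h2, -⟩
    by_contra hw
    exact h1 (isUnit_pencilOperator_of_injective h hw0 hw hlam h2)
  · intro hw
    have hinj : Function.Injective (pencilOperator a p q h lam) := by
      refine (injective_iff_map_eq_zero _).2 fun y hy => lp.ext ?_
      refine eq_zero_of_pencilExpr_eq_zero ha h hw hlam y.tendsto_cofinite fun n _ => ?_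
      rw [← pencilOperator_apply h, hy]
      rfl
    refine ⟨fun hu => ?_, hinj, denseRange_pencilOperator h hinj⟩
    -- A preimage of the unit vector at `0` solves the homogeneous equation at every `n ≠ 0`, hence
    -- vanishes.
    obtain ⟨y, hy⟩ := (ContinuousLinearMap.isUnit_iff_bijective.1 hu).2 (lp.single 2 0 (1 : ℂ))
    have hy0 : y = 0 := lp.ext <|
      eq_zero_of_pencilExpr_eq_zero ha h hw hlam (EllTwo.tendsto_cofinite y) fun n hn => by
        rw [← pencilOperator_apply h, hy, lp.single_apply_ne _ _ _ hn]
    have h1 := congrArg (fun v : EllTwo => v 0) hy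
    simp [hy0] at h1
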